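/- **Theorem 4.1.** For every $\theta>0$ there is a constant $\gamma(\theta)>0$, depending only on $\theta$, such that the following holds. Let $u_{jk}$, $1\le j\le m$, $1\le k\le n$, be jointly Gaussian (possibly degenerate) real random variables on a common probability space such that $$\mathbf{E}\,u_{jk}=0\quad\text{and}\quad \mathbf{E}\,u_{jk}^2\le\frac{\theta}{m+n}\qquad\text{for all } j,k,$$ $$\left|\mathbf{E}\,u_{j_1k_1}u_{j_2k_2}\right|\le\frac{\theta}{(m+n)^2}\qquad\text{whenever } j_1\ne j_2 \text{ and } k_1\ne k_2.$$ Let $U=\sum_{j=1}^m\sum_{k=1}^n u_{jk}^3$. Then $U^2$ is integrable and $\mathbf{E}\,U^2\le\gamma(\theta)$. Moreover, for every $0<\epsilon\le 1/2$, $$\left|\mathbf{E}\,e^{iU}-\exp\left\{-\tfrac12\mathbf{E}\,U^2\right\}\right|\le\epsilon\qquad\text{provided}\qquad m+n\ge\left(\frac1\epsilon\right)^{\gamma(\theta)},$$ where $i=\sqrt{-1}$. -/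

import Mathlib

open MeasureTheory ProbabilityTheory

/-- The random variable `U = ∑ u_jk ^ 3` of an `m × n` array of random variables. -/
noncomputable def cubicSum {m n : ℕ} {Ω : Type*} (u : Fin m → Fin n → Ω → ℝ) (ω : Ω) : ℝ :=
  ∑ j, ∑ k, u j k ω ^ 3

/-! ### Gaussian integration by parts -/

section Stein

variable {E : Type*} [NormedAddCommGroup E] [NormedSpace ℝ E]

/-! Write φ(t) = 𝔼 e^{itU} and p = √(m+n), so that every entry has standard deviation O(1/p). The
point is that φ nearly solves φ' = -t 𝔼U² φ, the equation satisfied by a centred normal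
characteristic function. Gaussian integration by parts (`integral_coord_smul`) is applied with the
weight e^{itU} (`expWeighted_coord_mul`): contracting x_a with the other polynomial factors gives
Wick terms, and contracting it with the weight gives 3it ∑_b c_ab x_b², where c is the covariance.
Applied to φ' = i ∑_a 𝔼 x_a³ e^{itU}, this produces terms of size p⁻⁴; a further expansion isolates
exactly the Wick value of 𝔼U² times φ, with remainders of size p⁻⁵ (`exists_expWeighted_expansion`,
`integral_sumCubes_sq`).

The covariance hypotheses enter only through variances at most θ/p² and absolute row sums at most 2θ
(`sum_abs_coordCov_le`). Summing over at most p⁴ entries leaves an error O(t²/p) in the differential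
equation, and the integrating factor e^{t²𝔼U²/2} on [0,1] turns it into |φ(1) - e^{-𝔼U²/2}| ≤
K(θ)/p. Since 1/ε ≥ 2, a suitable power of 1/ε absorbs K (`mul_le_of_rpow_le`). -/

lemma hasDerivAt_gaussianPDFReal_zero {v : NNReal} (s : ℝ) :
    HasDerivAt (gaussianPDFReal 0 v) (-(s / v) * gaussianPDFReal 0 v s) s := by
  simp only [gaussianPDFReal_def, sub_zero]
  have h : HasDerivAt (fun x : ℝ => -x ^ 2 / (2 * (v : ℝ))) (-(s / v)) s := by
    convert! ((hasDerivAt_pow 2 s).neg.div_const (2 * (v : ℝ))) using 1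
    rcases eq_or_ne (v : ℝ) 0 with h | h
    · simp [h]
    · field_simp
      simp [mul_comm]
  convert! h.exp.const_mul (√(2 * Real.pi * v))⁻¹ using 1
  ring

lemma integrable_gaussianReal_iff {v : NNReal} (hv : v ≠ 0) {f : ℝ → E} :
    Integrable f (gaussianReal 0 v) ↔ Integrable (fun s => gaussianPDFReal 0 v s • f s) := by
  rw [gaussianReal_of_var_ne_zero _ hv,
    integrable_withDensity_iff_integrable_smul' (measurable_gaussianPDF _ _)
      (ae_of_all _ fun _ => gaussianPDF_lt_top)]
  simp

/-- Stein's identity for a centred normal law on the line. -/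
lemma integral_smul_gaussianReal {v : NNReal} (hv : v ≠ 0) {f f' : ℝ → E}
    (hf : ∀ s, HasDerivAt f (f' s) s) (h0 : Integrable f (gaussianReal 0 v))
    (h1 : Integrable (fun s => s • f s) (gaussianReal 0 v))
    (h2 : Integrable f' (gaussianReal 0 v)) :
    ∫ s, s • f s ∂(gaussianReal 0 v) = (v : ℝ) • ∫ s, f' s ∂(gaussianReal 0 v) := by
  have hv' : (v : ℝ) ≠ 0 := by exact_mod_cast hv
  rw [integrable_gaussianReal_iff hv] at h0 h1 h2
  -- With ρ the density, (ρf)' = ρf' - (s/v)ρf has integral zero over the line.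
  have key := integral_eq_zero_of_hasDerivAt_of_integrable
    (fun s => (hasDerivAt_gaussianPDFReal_zero (v := v) s).smul (hf s))
    (f := fun s => gaussianPDFReal 0 v s • f s) ?_ h0
  · rw [integral_gaussianReal_eq_integral_smul hv, integral_gaussianReal_eq_integral_smul hv]
    have e : ∀ s, gaussianPDFReal 0 v s • f' s + (-(s / v) * gaussianPDFReal 0 v s) • f s
        = gaussianPDFReal 0 v s • f' s - (v : ℝ)⁻¹ • gaussianPDFReal 0 v s • s • f s := by
      intro s
      rw [sub_eq_add_neg, smul_smul, smul_smul, ← neg_smul]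
      congr 2
      field_simp
    simp_rw [e] at key
    rw [integral_sub h2 (h1.fun_smul _), integral_smul, sub_eq_zero] at key
    rw [key, smul_smul, mul_inv_cancel₀ hv', one_smul]
  · have := h2.sub (h1.smul (v : ℝ)⁻¹)
    refine this.congr (ae_of_all _ fun s => ?_)
    simp only [Pi.sub_apply, Pi.smul_apply]
    rw [sub_eq_add_neg, smul_smul, smul_smul, ← neg_smul]
    congr 2
    field_simp

end Stein

/-! ### Integration by parts in finitely many variables, degenerate covariance allowed. -/

section Parts

variable {ι : Type*} {E : Type*} [NormedAddCommGroup E] [NormedSpace ℝ E]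

/-- The second mixed moments of a law on `ι → ℝ`. -/
noncomputable def coordCov (μ : Measure (ι → ℝ)) (a b : ι) : ℝ := ∫ x, x a * x b ∂μ

lemma coordCov_self_nonneg (μ : Measure (ι → ℝ)) (a : ι) : 0 ≤ coordCov μ a a :=
  integral_nonneg fun x => mul_self_nonneg (x a)

variable [Fintype ι] (μ : Measure (ι → ℝ)) [IsGaussian μ]

lemma memLp_coord (a : ι) {p : ENNReal} (hp : p ≠ ⊤) : MemLp (fun x : ι → ℝ => x a) p μ :=
  IsGaussian.memLp_dual μ (ContinuousLinearMap.proj a) p hp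

lemma integrable_coord_mul (a b : ι) : Integrable (fun x : ι → ℝ => x a * x b) μ :=
  (memLp_coord μ a (p := 2) ENNReal.ofNat_ne_top).integrable_mul
    (memLp_coord μ b (p := 2) ENNReal.ofNat_ne_top)

variable {μ}

lemma ae_coord_eq_zero {a : ι} (h : coordCov μ a a = 0) : ∀ᵐ x ∂μ, x a = 0 := by
  have := (integral_eq_zero_iff_of_nonneg (fun x : ι → ℝ => mul_self_nonneg (x a))
    (integrable_coord_mul μ a a)).1 h
  filter_upwards [this] with x hx
  simpa using hx

/-- Regression: `x a` is independent of the residuals of all coordinates. -/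
lemma map_regression (h0 : ∀ a, ∫ x, x a ∂μ = 0) {a : ι} (ha : coordCov μ a a ≠ 0) :
    μ.map (fun x => (x a, x - (x a / coordCov μ a a) • coordCov μ a)) =
      (gaussianReal 0 (coordCov μ a a).toNNReal).prod
        (μ.map (fun x => x - (x a / coordCov μ a a) • coordCov μ a)) := by
  have hind : IndepFun (fun x : ι → ℝ => x a)
      (fun x => x - (x a / coordCov μ a a) • coordCov μ a) μ := by
    -- The independence criterion compares two families of coordinates, so x_a is presented as a
    -- family over `Unit`.
    let L : (ι → ℝ) →L[ℝ] (Unit → ℝ) × (ι → ℝ) :=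
      (ContinuousLinearMap.pi fun _ => ContinuousLinearMap.proj a).prod
        (ContinuousLinearMap.id ℝ _ - ((coordCov μ a a)⁻¹ •
          (ContinuousLinearMap.proj a : (ι → ℝ) →L[ℝ] ℝ)).smulRight (coordCov μ a))
    have hL : HasGaussianLaw (fun x : ι → ℝ => ((fun _ : Unit => x a),
        fun j => x j - x a / coordCov μ a a * coordCov μ a j)) μ := by
      convert! (IsGaussian.hasGaussianLaw_id (μ := μ)).map_fun L using 2
      ext j
      · simp [L]
      · simp [L, div_eq_inv_mul]
    have := hL.indepFun_of_covariance_eval (X := fun _ (x : ι → ℝ) => x a)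
      (Y := fun j (x : ι → ℝ) => x j - x a / coordCov μ a a * coordCov μ a j) fun _ j => by
        -- For jointly Gaussian families it suffices that c_aj - (c_aj / c_aa) c_aa = 0.
        have m : ∀ b, MemLp (fun x : ι → ℝ => x b) 2 μ :=
          fun b => memLp_coord μ b ENNReal.ofNat_ne_top
        have e : ∀ x : ι → ℝ, x a / coordCov μ a a * coordCov μ a j
            = (coordCov μ a j / coordCov μ a a) * x a := fun x => by ring
        simp_rw [e]
        rw [covariance_fun_sub_right (m a) (m j) ((m a).const_mul _), covariance_const_mul_right,
          covariance_eq_sub (m a) (m j), covariance_eq_sub (m a) (m a)]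
        simp only [h0, Pi.mul_apply, mul_zero, sub_zero]
        change coordCov μ a j - _ * coordCov μ a a = 0
        field_simp
        ring
    exact this.comp (φ := fun y : Unit → ℝ => y ()) (ψ := id) (by fun_prop) measurable_id
  rw [(indepFun_iff_map_prod_eq_prod_map_map 
    (measurable_pi_apply a).aemeasurable (by fun_prop)).1 hind]
  congr 1
  have hg : HasGaussianLaw (fun x : ι → ℝ => x a) μ :=
    (IsGaussian.hasGaussianLaw_id (μ := μ)).map_fun (ContinuousLinearMap.proj a)
  rw [hg.map_eq_gaussianReal, variance_eq_sub (memLp_coord μ a ENNReal.ofNat_ne_top)]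
  simp [h0, coordCov, pow_two]

/-- Gaussian integration by parts: `𝔼 x_a F(x) = 𝔼 ∂_c F(x)`, where `c_b = 𝔼 x_a x_b`. -/
theorem integral_coord_smul (h0 : ∀ a, ∫ x, x a ∂μ = 0) (a : ι) {F D : (ι → ℝ) → E}
    (hF : ∀ x, HasDerivAt (fun s : ℝ => F (x + s • coordCov μ a)) (D x) 0)
    (cF : Continuous F) (cD : Continuous D) (iF : Integrable F μ)
    (iaF : Integrable (fun x => x a • F x) μ) (iD : Integrable D μ) :
    ∫ x, x a • F x ∂μ = ∫ x, D x ∂μ := by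
  by_cases ha : coordCov μ a a = 0
  -- In the degenerate case x_a = 0 almost surely, so c = 0 and both sides vanish.
  · have hae := ae_coord_eq_zero ha
    have hc : coordCov μ a = 0 := by
      ext b
      exact integral_eq_zero_of_ae (by filter_upwards [hae] with x hx; simp [hx])
    have hD : ∀ x, D x = 0 := fun x => by
      have := hF x
      simp only [hc, smul_zero, add_zero] at this
      exact this.unique (hasDerivAt_const _ _)
    simp only [hD, integral_zero]
    exact integral_eq_zero_of_ae (by filter_upwards [hae] with x hx; simp [hx])
  have hmap := map_regression h0 ha
  have σ0 := coordCov_self_nonneg μ a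
  obtain ⟨σ, hσ⟩ : ∃ σ, σ = coordCov μ a a := ⟨_, rfl⟩
  obtain ⟨c, hc⟩ : ∃ c, c = coordCov μ a := ⟨_, rfl⟩
  rw [← hσ] at hmap ha σ0
  rw [← hc] at hmap
  rw [← hc] at hF
  set ν := μ.map (fun x : ι → ℝ => x - (x a / σ) • c) with hν
  have hνp : IsProbabilityMeasure ν := Measure.isProbabilityMeasure_map (by fun_prop)
  set π : (ι → ℝ) → ℝ × (ι → ℝ) := fun x => (x a, x - (x a / σ) • c) with hπ
  have mπ : Measurable π := by fun_prop
  have σpos : 0 < σ := lt_of_le_of_ne σ0 (Ne.symm ha)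
  have hv : σ.toNNReal ≠ 0 := by simpa using σpos
  let τ : ℝ × (ι → ℝ) → (ι → ℝ) := fun p => p.2 + (p.1 / σ) • c
  have cτ : Continuous τ := by fun_prop
  have hτ : ∀ x, τ (π x) = x := fun x => by simp [τ, π]
  -- Disintegration along the lines r + (s/σ)c: s is normal with variance σ and independent of the
  -- residual r.
  have tr : ∀ G : ℝ → (ι → ℝ) → E, Continuous (fun p : ℝ × (ι → ℝ) => G p.1 (τ p)) →
      Integrable (fun x => G (x a) x) μ →
      Integrable (fun p : ℝ × (ι → ℝ) => G p.1 (τ p)) ((gaussianReal 0 σ.toNNReal).prod ν) ∧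
      ∫ x, G (x a) x ∂μ = ∫ r, ∫ s, G s (τ (s, r)) ∂(gaussianReal 0 σ.toNNReal) ∂ν := by
    intro G hG iG
    have e : (fun x => G (x a) x) = (fun p : ℝ × (ι → ℝ) => G p.1 (τ p)) ∘ π := by
      ext x
      simp only [Function.comp, hτ]
      rfl
    have iG' : Integrable (fun p : ℝ × (ι → ℝ) => G p.1 (τ p)) (μ.map π) := by
      rw [integrable_map_measure hG.aestronglyMeasurable mπ.aemeasurable, ← e]
      exact iG
    refine ⟨hmap ▸ iG', ?_⟩
    rw [← integral_prod_symm (fun p : ℝ × (ι → ℝ) => G p.1 (τ p)) (hmap ▸ iG'), ← hmap,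
      integral_map mπ.aemeasurable hG.aestronglyMeasurable]
    exact congrArg (fun g => ∫ x, g x ∂μ) e
  obtain ⟨j0, -⟩ := tr (fun _ x => F x) (by fun_prop) iF
  obtain ⟨j1, e1⟩ := tr (fun s x => s • F x) (by fun_prop) iaF
  obtain ⟨j2, e2⟩ := tr (fun _ x => D x) (by fun_prop) iD
  rw [e1, e2]
  refine integral_congr_ae ?_
  filter_upwards [j0.prod_left_ae, j1.prod_left_ae, j2.prod_left_ae] with r k0 k1 k2
  -- Along each line the derivative is D/σ; the variance σ in Stein's identity cancels this factor.
  have hd : ∀ s : ℝ, HasDerivAt (fun s => F (τ (s, r))) (σ⁻¹ • D (τ (s, r))) s := by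
    intro s
    have h1 : HasDerivAt (fun s' : ℝ => (s' - s) / σ) (σ⁻¹) s := by
      simpa using ((hasDerivAt_id s).sub_const s).div_const σ
    have h2 : HasDerivAt (fun q : ℝ => F (τ (s, r) + q • c)) (D (τ (s, r))) ((s - s) / σ) := by
      simpa using hF (τ (s, r))
    convert! HasDerivAt.scomp s h2 h1 using 1
    ext s'
    simp only [τ, Function.comp]
    congr 1
    rw [add_assoc, ← add_smul]
    congr 2
    ring
  have := integral_smul_gaussianReal hv hd k0 k1 (k2.smul σ⁻¹)
  rw [this, integral_smul, smul_smul, Real.coe_toNNReal _ σpos.le, mul_inv_cancel₀ ha, one_smul]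

end Parts

/-! ### Functions of polynomial growth -/

section Growth

variable {ι : Type*} [Fintype ι] {E : Type*} [NormedAddCommGroup E]

/-- Continuous functions of at most polynomial growth. -/
def HasPolyGrowth (F : (ι → ℝ) → E) : Prop :=
  Continuous F ∧ ∃ (K : ℝ) (k : ℕ), 0 ≤ K ∧ ∀ x, ‖F x‖ ≤ K * (1 + ‖x‖) ^ k

namespace HasPolyGrowth

lemma const (v : E) : HasPolyGrowth (fun _ : ι → ℝ => v) :=
  ⟨continuous_const, ‖v‖, 0, norm_nonneg _, fun x => by simp⟩

lemma coord (a : ι) : HasPolyGrowth (fun x : ι → ℝ => x a) :=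
  ⟨continuous_apply a, 1, 1, zero_le_one, fun x => by
    have := norm_le_pi_norm x a
    simp only [pow_one, one_mul]
    linarith⟩

lemma mul {R : Type*} [NormedRing R] {F G : (ι → ℝ) → R} (hF : HasPolyGrowth F)
    (hG : HasPolyGrowth G) : HasPolyGrowth (fun x => F x * G x) := by
  obtain ⟨cF, K, k, hK, bF⟩ := hF
  obtain ⟨cG, L, l, hL, bG⟩ := hG
  refine ⟨cF.mul cG, K * L, k + l, mul_nonneg hK hL, fun x => (norm_mul_le _ _).trans ?_⟩
  calc ‖F x‖ * ‖G x‖ ≤ (K * (1 + ‖x‖) ^ k) * (L * (1 + ‖x‖) ^ l) := by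
        gcongr
        · exact bF x
        · exact bG x
    _ = _ := by ring

lemma add {F G : (ι → ℝ) → E} (hF : HasPolyGrowth F) (hG : HasPolyGrowth G) :
    HasPolyGrowth (fun x => F x + G x) := by
  obtain ⟨cF, K, k, hK, bF⟩ := hF
  obtain ⟨cG, L, l, hL, bG⟩ := hG
  refine ⟨cF.add cG, K + L, k + l, add_nonneg hK hL, fun x => (norm_add_le _ _).trans ?_⟩
  have h1 : 1 ≤ 1 + ‖x‖ := by linarith [norm_nonneg x]
  have hk : (1 + ‖x‖) ^ k ≤ (1 + ‖x‖) ^ (k + l) := pow_le_pow_right₀ h1 (by omega)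
  have hl : (1 + ‖x‖) ^ l ≤ (1 + ‖x‖) ^ (k + l) := pow_le_pow_right₀ h1 (by omega)
  calc ‖F x‖ + ‖G x‖ ≤ K * (1 + ‖x‖) ^ k + L * (1 + ‖x‖) ^ l := add_le_add (bF x) (bG x)
    _ ≤ K * (1 + ‖x‖) ^ (k + l) + L * (1 + ‖x‖) ^ (k + l) := by gcongr
    _ = _ := by ring

lemma sum {κ : Type*} (s : Finset κ) {F : κ → (ι → ℝ) → E} (hF : ∀ i, HasPolyGrowth (F i)) :
    HasPolyGrowth (fun x => ∑ i ∈ s, F i x) := by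
  classical
  induction s using Finset.induction_on with
  | empty => simpa using const (0 : E)
  | insert i s hi ih =>
    simp only [Finset.sum_insert hi]
    exact (hF i).add ih

lemma pow {F : (ι → ℝ) → ℝ} (hF : HasPolyGrowth F) (n : ℕ) :
    HasPolyGrowth (fun x => F x ^ n) := by
  induction n with
  | zero => simpa using const (1 : ℝ)
  | succ n ih =>
    simp only [pow_succ]
    exact ih.mul hF

lemma ofReal {F : (ι → ℝ) → ℝ} (hF : HasPolyGrowth F) :
    HasPolyGrowth (fun x => (F x : ℂ)) := by
  obtain ⟨cF, K, k, hK, bF⟩ := hF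
  exact ⟨by fun_prop, K, k, hK, fun x => by simpa using bF x⟩

lemma cexp_mul_I {F : (ι → ℝ) → ℝ} (hF : HasPolyGrowth F) :
    HasPolyGrowth (fun x => Complex.exp (Complex.I * (F x : ℂ))) := by
  have := hF.1
  refine ⟨by fun_prop, 1, 0, zero_le_one, fun x => ?_⟩
  change ‖Complex.exp (Complex.I * (F x : ℂ))‖ ≤ _
  rw [mul_comm, Complex.norm_exp_ofReal_mul_I]
  simp

/-- A Gaussian measure has moments of the norm of every order. This settles the integrability
conditions for the weighted expectations below. -/
lemma integrable {F : (ι → ℝ) → E} (hF : HasPolyGrowth F) (μ : Measure (ι → ℝ)) [IsGaussian μ] :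
    Integrable F μ := by
  obtain ⟨cF, K, k, hK, bF⟩ := hF
  have h1 : MemLp (fun x : ι → ℝ => ‖x‖) k μ :=
    (IsGaussian.memLp_id μ k (ENNReal.natCast_ne_top k)).norm
  have h : MemLp (fun x : ι → ℝ => 1 + ‖x‖) k μ := (memLp_const (1 : ℝ)).add h1
  have hi : Integrable (fun x : ι → ℝ => K * ‖1 + ‖x‖‖ ^ k) μ :=
    h.integrable_norm_pow'.const_mul K
  refine hi.mono' cF.aestronglyMeasurable (ae_of_all _ fun x => (bF x).trans_eq ?_)
  rw [Real.norm_of_nonneg (add_nonneg zero_le_one (norm_nonneg x))]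

end HasPolyGrowth

end Growth

/-! ### Expectations weighted by the exponential of a cubic form -/

section Weighted

variable {ι : Type*} [Fintype ι]

/-- The sum of the cubes of the coordinates. -/
noncomputable def sumCubes (x : ι → ℝ) : ℝ := ∑ a, x a ^ 3

/-- The expectation of `M e^{itU}` where `U` is the sum of the cubes of the coordinates. -/
noncomputable def expWeighted (μ : Measure (ι → ℝ)) (t : ℝ) (M : (ι → ℝ) → ℝ) : ℂ :=
  ∫ x, (M x : ℂ) * Complex.exp (Complex.I * ((t * sumCubes x : ℝ) : ℂ)) ∂μ

lemma hasPolyGrowth_sumCubes : HasPolyGrowth (sumCubes : (ι → ℝ) → ℝ) :=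
  HasPolyGrowth.sum _ fun a => (HasPolyGrowth.coord a).pow 3

lemma HasPolyGrowth.weighted {M : (ι → ℝ) → ℝ} (hM : HasPolyGrowth M) (t : ℝ) :
    HasPolyGrowth
      (fun x => (M x : ℂ) * Complex.exp (Complex.I * ((t * sumCubes x : ℝ) : ℂ))) :=
  hM.ofReal.mul ((HasPolyGrowth.const t).mul hasPolyGrowth_sumCubes).cexp_mul_I

variable (μ : Measure (ι → ℝ)) (t : ℝ)

lemma expWeighted_zero (M : (ι → ℝ) → ℝ) : expWeighted μ 0 M = ((∫ x, M x ∂μ : ℝ) : ℂ) := by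
  simp only [expWeighted, zero_mul, Complex.ofReal_zero, mul_zero, Complex.exp_zero, mul_one]
  exact integral_ofReal

/-- The weight has modulus one, so remainders are controlled by absolute moments, uniformly in t. -/
lemma norm_expWeighted_le (M : (ι → ℝ) → ℝ) : ‖expWeighted μ t M‖ ≤ ∫ x, |M x| ∂μ := by
  refine (norm_integral_le_integral_norm _).trans_eq ?_
  congr 1
  ext x
  rw [norm_mul, mul_comm Complex.I, Complex.norm_exp_ofReal_mul_I]
  simp

variable [IsGaussian μ]

lemma expWeighted_linear {f g : (ι → ℝ) → ℝ} (hf : HasPolyGrowth f) (hg : HasPolyGrowth g)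
    (A B : ℝ) : expWeighted μ t (fun x => A * f x + B * g x) =
      A * expWeighted μ t f + B * expWeighted μ t g := by
  simp only [expWeighted, Complex.ofReal_add, Complex.ofReal_mul, add_mul, mul_assoc]
  rw [integral_add, integral_const_mul, integral_const_mul]
  · simpa using ((hf.weighted t).integrable μ).const_mul (A : ℂ)
  · simpa using ((hg.weighted t).integrable μ).const_mul (B : ℂ)

lemma expWeighted_sum {κ : Type*} (s : Finset κ) {F : κ → (ι → ℝ) → ℝ}
    (hF : ∀ i, HasPolyGrowth (F i)) :
    expWeighted μ t (fun x => ∑ i ∈ s, F i x) = ∑ i ∈ s, expWeighted μ t (F i) := by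
  simp only [expWeighted, Complex.ofReal_sum, Finset.sum_mul]
  exact integral_finsetSum _ fun i _ => ((hF i).weighted t).integrable μ

variable {μ}

omit [Fintype ι] in
lemma hasDerivAt_coord_line (x c : ι → ℝ) (b : ι) :
    HasDerivAt (fun s : ℝ => (x + s • c) b) (c b) 0 := by
  simpa using ((hasDerivAt_id (0 : ℝ)).mul_const (c b)).const_add (x b)

/-- Integration by parts against the weight `e^{itU}`. -/
lemma expWeighted_coord_mul (h0 : ∀ a, ∫ x, x a ∂μ = 0) (a : ι) {H M M' : (ι → ℝ) → ℝ}
    (hH : ∀ x, H x = x a * M x) (hM : HasPolyGrowth M) (hM' : HasPolyGrowth M')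
    (hd : ∀ x, HasDerivAt (fun s : ℝ => M (x + s • coordCov μ a)) (M' x) 0) :
    expWeighted μ t H = expWeighted μ t M' +
      3 * Complex.I * t * ∑ b, coordCov μ a b * expWeighted μ t (fun x => M x * x b ^ 2) := by
  set c := coordCov μ a
  have hMU : HasPolyGrowth (fun x => M x * ∑ b, 3 * x b ^ 2 * c b) :=
    hM.mul (HasPolyGrowth.sum _ fun b =>
      ((HasPolyGrowth.const 3).mul ((HasPolyGrowth.coord b).pow 2)).mul (HasPolyGrowth.const (c b)))
  have key := integral_coord_smul h0 a (F := fun x =>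
      (M x : ℂ) * Complex.exp (Complex.I * ((t * sumCubes x : ℝ) : ℂ)))
    (D := fun x => (M' x : ℂ) * Complex.exp (Complex.I * ((t * sumCubes x : ℝ) : ℂ)) +
      (Complex.I * t) * (((M x * ∑ b, 3 * x b ^ 2 * c b : ℝ) : ℂ) *
        Complex.exp (Complex.I * ((t * sumCubes x : ℝ) : ℂ)))) ?_
    (hM.weighted t).1 ((hM'.weighted t).add ((HasPolyGrowth.const _).mul (hMU.weighted t))).1
    ((hM.weighted t).integrable μ) ?_
    (((hM'.weighted t).add ((HasPolyGrowth.const _).mul (hMU.weighted t))).integrable μ)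
  · have e1 : expWeighted μ t H = ∫ x, x a •
        ((M x : ℂ) * Complex.exp (Complex.I * ((t * sumCubes x : ℝ) : ℂ))) ∂μ := by
      simp only [expWeighted, hH, Complex.real_smul, Complex.ofReal_mul, mul_assoc]
    rw [e1, key, integral_add ((hM'.weighted t).integrable μ)
      (((HasPolyGrowth.const _).mul (hMU.weighted t)).integrable μ), integral_const_mul]
    change expWeighted μ t M' + _ * expWeighted μ t _ = _
    congr 1
    -- The dummy `0 * 0` gives the two-term shape that `expWeighted_linear` expects; the same device
    -- recurs below.
    have e2 : (fun x : ι → ℝ => M x * ∑ b, 3 * x b ^ 2 * c b) =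
        fun x => ∑ b, ((3 * c b) * (M x * x b ^ 2) + 0 * 0) := by
      ext x
      rw [Finset.mul_sum]
      exact Finset.sum_congr rfl fun b _ => by ring
    have g : ∀ b, HasPolyGrowth (fun x : ι → ℝ => M x * x b ^ 2) :=
      fun b => hM.mul ((HasPolyGrowth.coord b).pow 2)
    rw [e2, expWeighted_sum μ t _ fun b => ((HasPolyGrowth.const _).mul (g b)).add
      (HasPolyGrowth.const _), Finset.mul_sum, Finset.mul_sum]
    refine Finset.sum_congr rfl fun b _ => ?_
    rw [expWeighted_linear μ t (g b) (HasPolyGrowth.const 0)]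
    push_cast
    ring
  · intro x
    have hU : HasDerivAt (fun s : ℝ => sumCubes (x + s • c)) (∑ b, 3 * x b ^ 2 * c b) 0 := by
      refine HasDerivAt.fun_sum fun b _ => ?_
      convert! (hasDerivAt_coord_line x c b).pow 3 using 1
      simp
    have := (hd x).ofReal_comp.mul (((hU.const_mul t).ofReal_comp.const_mul Complex.I).cexp)
    convert! this using 1
    simp only [zero_smul, add_zero]
    push_cast
    ring
  · have := ((HasPolyGrowth.coord a).ofReal.mul (hM.weighted t)).integrable μ
    simpa using this

/-- Gaussian integration by parts for real functions of polynomial growth. -/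
lemma integral_coord_mul (h0 : ∀ a, ∫ x, x a ∂μ = 0) (a : ι) {H M M' : (ι → ℝ) → ℝ}
    (hH : ∀ x, H x = x a * M x) (hM : HasPolyGrowth M) (hM' : HasPolyGrowth M')
    (hd : ∀ x, HasDerivAt (fun s : ℝ => M (x + s • coordCov μ a)) (M' x) 0) :
    ∫ x, H x ∂μ = ∫ x, M' x ∂μ := by
  have := expWeighted_coord_mul 0 h0 a hH hM hM' hd
  rw [expWeighted_zero, expWeighted_zero] at this
  simpa using this

end Weighted

section Moments

variable {ι : Type*} [Fintype ι] {μ : Measure (ι → ℝ)} [IsGaussian μ]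

/-! ### Moments of the coordinates -/

lemma integral_coord_pow_add_two (h0 : ∀ a, ∫ x, x a ∂μ = 0) (a : ι) (n : ℕ) :
    ∫ x, x a ^ (n + 2) ∂μ = (n + 1) * coordCov μ a a * ∫ x, x a ^ n ∂μ := by
  rw [← integral_const_mul]
  refine integral_coord_mul h0 a (M := fun x => x a ^ (n + 1)) (fun x => by ring)
    ((HasPolyGrowth.coord a).pow _)
    ((HasPolyGrowth.const _).mul ((HasPolyGrowth.coord a).pow _)) fun x => ?_
  convert! (hasDerivAt_coord_line x (coordCov μ a) a).pow (n + 1) using 1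
  simp
  ring

omit [Fintype ι] [IsGaussian μ] in
lemma integral_coord_sq (a : ι) : ∫ x, x a ^ 2 ∂μ = coordCov μ a a := by
  simp only [coordCov, pow_two]

lemma integral_coord_pow_four (h0 : ∀ a, ∫ x, x a ∂μ = 0) (a : ι) :
    ∫ x, x a ^ 4 ∂μ = 3 * coordCov μ a a ^ 2 := by
  rw [integral_coord_pow_add_two h0 a 2, integral_coord_sq]
  push_cast
  ring

lemma integral_coord_pow_eight (h0 : ∀ a, ∫ x, x a ∂μ = 0) (a : ι) :
    ∫ x, x a ^ 8 ∂μ = 105 * coordCov μ a a ^ 4 := by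
  rw [integral_coord_pow_add_two h0 a 6, integral_coord_pow_add_two h0 a 4,
    integral_coord_pow_four h0]
  push_cast
  ring

lemma integral_sq_mul_sq (h0 : ∀ a, ∫ x, x a ∂μ = 0) (a b : ι) :
    ∫ x, x a ^ 2 * x b ^ 2 ∂μ =
      coordCov μ a a * coordCov μ b b + 2 * coordCov μ a b ^ 2 := by
  have ga := HasPolyGrowth.coord a
  have gb := HasPolyGrowth.coord b
  rw [integral_coord_mul h0 a (M := fun x => x a * x b ^ 2)
    (M' := fun x => coordCov μ a a * x b ^ 2 + 2 * coordCov μ a b * (x a * x b))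
    (fun x => by ring) (ga.mul (gb.pow 2))
    (((HasPolyGrowth.const _).mul (gb.pow 2)).add ((HasPolyGrowth.const _).mul (ga.mul gb)))
    fun x => ?_, integral_add (((HasPolyGrowth.const _).mul (gb.pow 2)).integrable μ)
    (((HasPolyGrowth.const _).mul (ga.mul gb)).integrable μ), integral_const_mul,
    integral_const_mul, integral_coord_sq]
  · change _ + _ * coordCov μ a b = _
    ring
  · convert! (hasDerivAt_coord_line x (coordCov μ a) a).mul
      ((hasDerivAt_coord_line x (coordCov μ a) b).pow 2) using 1
    simp
    ring

lemma integral_coord_mul_cube (h0 : ∀ a, ∫ x, x a ∂μ = 0) (a b : ι) :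
    ∫ x, x a * x b ^ 3 ∂μ = 3 * coordCov μ a b * coordCov μ b b := by
  have gb := HasPolyGrowth.coord b
  rw [integral_coord_mul h0 a (M := fun x => x b ^ 3)
    (M' := fun x => 3 * coordCov μ a b * x b ^ 2)
    (fun x => rfl) (gb.pow 3) ((HasPolyGrowth.const _).mul (gb.pow 2))
    fun x => ?_, integral_const_mul, integral_coord_sq]
  convert! (hasDerivAt_coord_line x (coordCov μ a) b).pow 3 using 1
  simp
  ring

/-- One x_a pairs with either of the two other x_a or any of the three x_b. The bracket is kept in
the form in which it reappears in `exists_expWeighted_expansion`. -/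
lemma integral_cube_mul_cube (h0 : ∀ a, ∫ x, x a ∂μ = 0) (a b : ι) :
    ∫ x, x a ^ 3 * x b ^ 3 ∂μ = 3 * (coordCov μ a b *
      (3 * (coordCov μ a a * coordCov μ b b) + 2 * coordCov μ a b ^ 2)) := by
  have ga := HasPolyGrowth.coord a
  have gb := HasPolyGrowth.coord b
  rw [integral_coord_mul h0 a (M := fun x => x a ^ 2 * x b ^ 3)
    (M' := fun x => 2 * coordCov μ a a * (x a * x b ^ 3) +
      3 * coordCov μ a b * (x a ^ 2 * x b ^ 2))
    (fun x => by ring) ((ga.pow 2).mul (gb.pow 3))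
    (((HasPolyGrowth.const _).mul (ga.mul (gb.pow 3))).add
      ((HasPolyGrowth.const _).mul ((ga.pow 2).mul (gb.pow 2))))
    fun x => ?_, integral_add (((HasPolyGrowth.const _).mul (ga.mul (gb.pow 3))).integrable μ)
    (((HasPolyGrowth.const _).mul ((ga.pow 2).mul (gb.pow 2))).integrable μ), integral_const_mul,
    integral_const_mul, integral_coord_mul_cube h0, integral_sq_mul_sq h0]
  · ring
  · convert! ((hasDerivAt_coord_line x (coordCov μ a) a).pow 2).mul
      ((hasDerivAt_coord_line x (coordCov μ a) b).pow 3) using 1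
    simp
    ring

/-- The second moment of the sum of cubes, by Wick's formula. -/
lemma integral_sumCubes_sq (h0 : ∀ a, ∫ x, x a ∂μ = 0) :
    ∫ x, sumCubes x ^ 2 ∂μ = 3 * ∑ a, ∑ b, coordCov μ a b *
      (3 * (coordCov μ a a * coordCov μ b b) + 2 * coordCov μ a b ^ 2) := by
  have g : ∀ a b : ι, HasPolyGrowth (fun x : ι → ℝ => x a ^ 3 * x b ^ 3) := fun a b =>
    ((HasPolyGrowth.coord a).pow 3).mul ((HasPolyGrowth.coord b).pow 3)
  simp only [sumCubes, pow_two (Finset.sum _ _), Finset.sum_mul_sum]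
  rw [integral_finsetSum _ fun a _ => (HasPolyGrowth.sum _ (g a)).integrable μ, Finset.mul_sum]
  refine Finset.sum_congr rfl fun a _ => ?_
  rw [integral_finsetSum _ fun b _ => (g a b).integrable μ, Finset.mul_sum]
  exact Finset.sum_congr rfl fun b _ => integral_cube_mul_cube h0 a b

/-- With a common variance bound, |xy| ≤ (x² + y²)/2 does the work of Cauchy–Schwarz. -/
lemma abs_coordCov_le {v : ℝ} (hv : ∀ a, coordCov μ a a ≤ v) (a b : ι) :
    |coordCov μ a b| ≤ v := by
  have h : |coordCov μ a b| ≤ ∫ x, (1 / 2 : ℝ) * x a ^ 2 + (1 / 2) * x b ^ 2 ∂μ := by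
    refine (abs_integral_le_integral_abs).trans (integral_mono
      (integrable_coord_mul μ a b).abs ?_ fun x => ?_)
    · exact (((HasPolyGrowth.const _).mul ((HasPolyGrowth.coord a).pow 2)).add
        ((HasPolyGrowth.const _).mul ((HasPolyGrowth.coord b).pow 2))).integrable μ
    · simp only [abs_mul]
      nlinarith [sq_nonneg (|x a| - |x b|), sq_abs (x a), sq_abs (x b)]
  rw [integral_add (((HasPolyGrowth.const _).mul ((HasPolyGrowth.coord a).pow 2)).integrable μ)
    (((HasPolyGrowth.const _).mul ((HasPolyGrowth.coord b).pow 2)).integrable μ),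
    integral_const_mul, integral_const_mul, integral_coord_sq, integral_coord_sq] at h
  linarith [hv a, hv b]

/-! ### Absolute moments for small variances -/

/-- After rescaling by p, AM-GM gives |X|Y² ≤ X²/2 + Y⁴/2, and even moments are explicit. -/
lemma integral_abs_mul_sq_le (h0 : ∀ a, ∫ x, x a ∂μ = 0) {θ p : ℝ} (hp : 0 < p)
    (hσ : ∀ a, coordCov μ a a ≤ θ / p ^ 2) (a b : ι) :
    ∫ x, |x a * x b ^ 2| ∂μ ≤ (θ / 2 + 3 * θ ^ 2 / 2) / p ^ 3 := by
  have g1 := (HasPolyGrowth.const (ι := ι) (p ^ 2 / 2)).mul ((HasPolyGrowth.coord a).pow 2)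
  have g2 := (HasPolyGrowth.const (ι := ι) (p ^ 4 / 2)).mul ((HasPolyGrowth.coord b).pow 4)
  have h : p ^ 3 * ∫ x, |x a * x b ^ 2| ∂μ ≤
      ∫ x, p ^ 2 / 2 * x a ^ 2 + p ^ 4 / 2 * x b ^ 4 ∂μ := by
    rw [← integral_const_mul]
    refine integral_mono ((((HasPolyGrowth.coord a).mul
      ((HasPolyGrowth.coord b).pow 2)).integrable μ).abs.const_mul _)
      ((g1.add g2).integrable μ) fun x => ?_
    simp only [abs_mul, abs_pow, sq_abs]
    nlinarith [sq_nonneg (p * |x a| - (p * x b) ^ 2), sq_abs (x a)]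
  rw [integral_add (g1.integrable μ) (g2.integrable μ), integral_const_mul, integral_const_mul,
    integral_coord_sq, integral_coord_pow_four h0] at h
  rw [le_div_iff₀ (by positivity), mul_comm]
  have ha := hσ a
  have hb := hσ b
  rw [le_div_iff₀ (by positivity)] at ha hb
  have hb2 : (coordCov μ b b * p ^ 2) ^ 2 ≤ θ ^ 2 :=
    pow_le_pow_left₀ (mul_nonneg (coordCov_self_nonneg μ b) (by positivity)) hb 2
  nlinarith

/-- Again AM-GM, used twice: |X|Y²Z² ≤ X²/2 + Y⁸/4 + Z⁸/4 in rescaled variables; 105 = 7·5·3·1 is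
the normal eighth moment. -/
lemma integral_abs_mul_sq_mul_sq_le (h0 : ∀ a, ∫ x, x a ∂μ = 0) {θ p : ℝ} (hp : 0 < p)
    (hσ : ∀ a, coordCov μ a a ≤ θ / p ^ 2) (a b c : ι) :
    ∫ x, |x a * x b ^ 2 * x c ^ 2| ∂μ ≤ (θ / 2 + 105 * θ ^ 4 / 2) / p ^ 5 := by
  have g1 := (HasPolyGrowth.const (ι := ι) (p ^ 2 / 2)).mul ((HasPolyGrowth.coord a).pow 2)
  have g2 := (HasPolyGrowth.const (ι := ι) (p ^ 8 / 4)).mul ((HasPolyGrowth.coord b).pow 8)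
  have g3 := (HasPolyGrowth.const (ι := ι) (p ^ 8 / 4)).mul ((HasPolyGrowth.coord c).pow 8)
  have h : p ^ 5 * ∫ x, |x a * x b ^ 2 * x c ^ 2| ∂μ ≤
      ∫ x, p ^ 2 / 2 * x a ^ 2 + p ^ 8 / 4 * x b ^ 8 + p ^ 8 / 4 * x c ^ 8 ∂μ := by
    rw [← integral_const_mul]
    refine integral_mono (((((HasPolyGrowth.coord a).mul
      ((HasPolyGrowth.coord b).pow 2)).mul ((HasPolyGrowth.coord c).pow 2)).integrable
        μ).abs.const_mul _) (((g1.add g2).add g3).integrable μ) fun x => ?_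
    simp only [abs_mul, abs_pow, sq_abs]
    nlinarith [sq_nonneg (p * |x a| - (p * x b) ^ 2 * (p * x c) ^ 2), sq_abs (x a),
      sq_nonneg ((p * x b) ^ 4 - (p * x c) ^ 4)]
  rw [integral_add ((g1.add g2).integrable μ) (g3.integrable μ),
    integral_add (g1.integrable μ) (g2.integrable μ), integral_const_mul, integral_const_mul,
    integral_const_mul, integral_coord_sq, integral_coord_pow_eight h0,
    integral_coord_pow_eight h0] at h
  rw [le_div_iff₀ (by positivity), mul_comm]
  have ha := hσ a
  have hb := hσ b
  have hc := hσ c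
  rw [le_div_iff₀ (by positivity)] at ha hb hc
  have hb2 : (coordCov μ b b * p ^ 2) ^ 4 ≤ θ ^ 4 :=
    pow_le_pow_left₀ (mul_nonneg (coordCov_self_nonneg μ b) (by positivity)) hb 4
  have hc2 : (coordCov μ c c * p ^ 2) ^ 4 ≤ θ ^ 4 :=
    pow_le_pow_left₀ (mul_nonneg (coordCov_self_nonneg μ c) (by positivity)) hc 4
  rw [mul_pow, ← pow_mul] at hb2 hc2
  norm_num at hb2 hc2
  linarith

/-! ### Wick-type expansions of weighted expectations -/

variable (t : ℝ)

lemma expWeighted_coord (h0 : ∀ a, ∫ x, x a ∂μ = 0) (a : ι) :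
    expWeighted μ t (fun x => x a) = 3 * Complex.I * t *
      ∑ c, coordCov μ a c * expWeighted μ t (fun x => x c ^ 2) := by
  rw [expWeighted_coord_mul t h0 a (M := fun _ => 1) (M' := fun _ => 0) (fun x => by ring)
    (HasPolyGrowth.const 1) (HasPolyGrowth.const 0) fun x => hasDerivAt_const _ _]
  simp [expWeighted]

lemma expWeighted_mul (h0 : ∀ a, ∫ x, x a ∂μ = 0) (a b : ι) :
    expWeighted μ t (fun x => x a * x b) = coordCov μ a b * expWeighted μ t (fun _ => 1) +
      3 * Complex.I * t *
        ∑ c, coordCov μ a c * expWeighted μ t (fun x => x b * x c ^ 2) := by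
  rw [expWeighted_coord_mul t h0 a (M := fun x => x b)
    (M' := fun x => coordCov μ a b * 1 + 0 * 0) (fun x => rfl)
    (HasPolyGrowth.coord b) (HasPolyGrowth.const _) fun x => ?_,
    expWeighted_linear μ t (HasPolyGrowth.const 1) (HasPolyGrowth.const 0)]
  · simp
  · simpa using hasDerivAt_coord_line x (coordCov μ a) b

lemma expWeighted_sq (h0 : ∀ a, ∫ x, x a ∂μ = 0) (a : ι) :
    expWeighted μ t (fun x => x a ^ 2) = coordCov μ a a * expWeighted μ t (fun _ => 1) +
      3 * Complex.I * t *
        ∑ c, coordCov μ a c * expWeighted μ t (fun x => x a * x c ^ 2) := by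
  rw [← expWeighted_mul t h0]
  simp only [pow_two]

/-- The coefficient of φ is the unweighted moment. Every other expectation has odd degree, and this
is where the extra factor 1/p comes from. -/
lemma expWeighted_sq_mul_sq (h0 : ∀ a, ∫ x, x a ∂μ = 0) (a b : ι) :
    expWeighted μ t (fun x => x a ^ 2 * x b ^ 2) =
      (coordCov μ a a * coordCov μ b b + 2 * coordCov μ a b ^ 2) * expWeighted μ t (fun _ => 1) +
      3 * Complex.I * t *
        (∑ c, coordCov μ a c * expWeighted μ t (fun x => x a * x b ^ 2 * x c ^ 2) +
        coordCov μ a a * ∑ c, coordCov μ b c * expWeighted μ t (fun x => x b * x c ^ 2) +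
        2 * coordCov μ a b * ∑ c, coordCov μ a c * expWeighted μ t (fun x => x b * x c ^ 2)) := by
  have ga := HasPolyGrowth.coord a
  have gb := HasPolyGrowth.coord b
  rw [expWeighted_coord_mul t h0 a (M := fun x => x a * x b ^ 2)
    (M' := fun x => coordCov μ a a * x b ^ 2 + 2 * coordCov μ a b * (x a * x b))
    (fun x => by ring) (ga.mul (gb.pow 2))
    (((HasPolyGrowth.const _).mul (gb.pow 2)).add ((HasPolyGrowth.const _).mul (ga.mul gb)))
    fun x => ?_, expWeighted_linear μ t (gb.pow 2) (ga.mul gb), expWeighted_sq t h0,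
    expWeighted_mul t h0]
  · push_cast
    ring
  · convert! (hasDerivAt_coord_line x (coordCov μ a) a).mul
      ((hasDerivAt_coord_line x (coordCov μ a) b).pow 2) using 1
    simp
    ring

/-- Contracting x_a within x_a³ leaves 2c_aa x_a, which is integrated by parts once more so that
both contributions become sums over b with the same coefficients c_ab. -/
lemma expWeighted_cube (h0 : ∀ a, ∫ x, x a ∂μ = 0) (a : ι) :
    expWeighted μ t (fun x => x a ^ 3) = 3 * Complex.I * t *
      ∑ b, coordCov μ a b * (expWeighted μ t (fun x => x a ^ 2 * x b ^ 2) +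
        2 * coordCov μ a a * expWeighted μ t (fun x => x b ^ 2)) := by
  have ga := HasPolyGrowth.coord a
  rw [expWeighted_coord_mul t h0 a (M := fun x => x a ^ 2)
    (M' := fun x => 2 * coordCov μ a a * x a + 0 * 0) (fun x => by ring) (ga.pow 2)
    (((HasPolyGrowth.const _).mul ga).add (HasPolyGrowth.const _))
    fun x => ?_, expWeighted_linear μ t ga (HasPolyGrowth.const 0), expWeighted_coord t h0]
  · simp only [mul_add, Finset.sum_add_distrib]
    rw [Finset.mul_sum, Finset.mul_sum, Finset.mul_sum, Finset.mul_sum]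
    push_cast
    rw [zero_mul, add_zero, add_comm]
    congr 1
    exact Finset.sum_congr rfl fun b _ => by ring
  · convert! (hasDerivAt_coord_line x (coordCov μ a) a).pow 2 using 1
    simp
    ring

end Moments

section Clt

/-! ### The characteristic function of the sum of cubes -/

lemma norm_sum_mul_le {κ : Type*} (s : Finset κ) {C : κ → ℝ} {z : κ → ℂ} {A B : ℝ}
    (hC : ∑ i ∈ s, |C i| ≤ A) (hB : 0 ≤ B) (hz : ∀ i, ‖z i‖ ≤ B) :
    ‖∑ i ∈ s, (C i : ℂ) * z i‖ ≤ A * B := by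
  calc ‖∑ i ∈ s, (C i : ℂ) * z i‖ ≤ ∑ i ∈ s, ‖(C i : ℂ) * z i‖ := norm_sum_le _ _
    _ ≤ ∑ i ∈ s, |C i| * B := Finset.sum_le_sum fun i _ => by
        rw [norm_mul, Complex.norm_real, Real.norm_eq_abs]
        exact mul_le_mul_of_nonneg_left (hz i) (abs_nonneg _)
    _ = (∑ i ∈ s, |C i|) * B := (Finset.sum_mul _ _ _).symm
    _ ≤ A * B := mul_le_mul_of_nonneg_right hC hB

variable {ι : Type*} [Fintype ι] {μ : Measure (ι → ℝ)} [IsGaussian μ]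

/-- A bound for the remainder of the two-step expansion of `𝔼 x_a² x_b² e^{itU}`. -/
noncomputable def cubicRemainder (θ : ℝ) : ℝ :=
  2 * θ * (θ / 2 + 105 * θ ^ 4 / 2) + 10 * θ ^ 2 * (θ / 2 + 3 * θ ^ 2 / 2)

lemma cubicRemainder_nonneg {θ : ℝ} (hθ : 0 ≤ θ) : 0 ≤ cubicRemainder θ := by
  unfold cubicRemainder
  positivity

/-- The coefficient 3 is 1 + 2: one c_aa c_bb from x_a² x_b², two from 2c_aa x_b². Row sums cost
only a constant, so remainders keep the sizes p⁻⁵ and p⁻²·p⁻³. -/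
lemma exists_expWeighted_expansion (h0 : ∀ a, ∫ x, x a ∂μ = 0) {θ p : ℝ} (hθ : 0 ≤ θ)
    (hp : 0 < p) (hσ : ∀ a, coordCov μ a a ≤ θ / p ^ 2)
    (hrow : ∀ a, ∑ b, |coordCov μ a b| ≤ 2 * θ) (t : ℝ) (a b : ι) :
    ∃ R : ℂ, ‖R‖ ≤ cubicRemainder θ / p ^ 5 ∧
      expWeighted μ t (fun x => x a ^ 2 * x b ^ 2) +
        2 * coordCov μ a a * expWeighted μ t (fun x => x b ^ 2) =
      (3 * (coordCov μ a a * coordCov μ b b) + 2 * coordCov μ a b ^ 2) *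
        expWeighted μ t (fun _ => 1) + 3 * Complex.I * t * R := by
  set K3 := θ / 2 + 3 * θ ^ 2 / 2 with hK3
  set K5 := θ / 2 + 105 * θ ^ 4 / 2 with hK5
  have k3 : 0 ≤ K3 / p ^ 3 := by positivity
  have k5 : 0 ≤ K5 / p ^ 5 := by positivity
  have s1 := norm_sum_mul_le Finset.univ (hrow a) k5 fun c =>
    (norm_expWeighted_le μ t _).trans (integral_abs_mul_sq_mul_sq_le h0 hp hσ a b c)
  have s2 : ∀ d, _ := fun d => norm_sum_mul_le Finset.univ (hrow d) k3 fun c =>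
    (norm_expWeighted_le μ t _).trans (integral_abs_mul_sq_le h0 hp hσ b c)
  set S1 := ∑ c, (coordCov μ a c : ℂ) * expWeighted μ t (fun x => x a * x b ^ 2 * x c ^ 2)
  set S2 := ∑ c, (coordCov μ b c : ℂ) * expWeighted μ t (fun x => x b * x c ^ 2) with hS2
  set S3 := ∑ c, (coordCov μ a c : ℂ) * expWeighted μ t (fun x => x b * x c ^ 2) with hS3
  have h2 : ‖S2‖ ≤ 2 * θ * (K3 / p ^ 3) := s2 b
  have h3 : ‖S3‖ ≤ 2 * θ * (K3 / p ^ 3) := s2 a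
  refine ⟨S1 + coordCov μ a a * S2 + 2 * coordCov μ a b * S3 + 2 * coordCov μ a a * S2, ?_, ?_⟩
  · have va : ‖(coordCov μ a a : ℂ)‖ ≤ θ / p ^ 2 := by
      simpa using abs_coordCov_le hσ a a
    have vab : ‖(coordCov μ a b : ℂ)‖ ≤ θ / p ^ 2 := by
      simpa using abs_coordCov_le hσ a b
    have hv : 0 ≤ θ / p ^ 2 := by positivity
    have m1 : ‖(coordCov μ a a : ℂ) * S2‖ ≤ θ / p ^ 2 * (2 * θ * (K3 / p ^ 3)) := by
      rw [norm_mul]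
      exact mul_le_mul va h2 (norm_nonneg _) hv
    have m2 : ‖(coordCov μ a b : ℂ) * S3‖ ≤ θ / p ^ 2 * (2 * θ * (K3 / p ^ 3)) := by
      rw [norm_mul]
      exact mul_le_mul vab h3 (norm_nonneg _) hv
    -- The five is 1 + 2 + 2, counting the cubic remainder sums with multiplicity.
    have e : cubicRemainder θ / p ^ 5 =
        2 * θ * (K5 / p ^ 5) + 5 * (θ / p ^ 2 * (2 * θ * (K3 / p ^ 3))) := by
      rw [cubicRemainder, ← hK3, ← hK5]
      field_simp
      ring
    rw [e, mul_assoc 2, mul_assoc 2]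
    refine (norm_add_le _ _).trans ?_
    refine (add_le_add_left (norm_add_le _ _) _).trans ?_
    refine (add_le_add_left (add_le_add_left (norm_add_le _ _) _) _).trans ?_
    rw [norm_mul 2, norm_mul 2, Complex.norm_ofNat]
    linarith
  · rw [expWeighted_sq_mul_sq t h0, expWeighted_sq t h0 b]
    ring

/-- The characteristic function `φ` of the sum of cubes nearly satisfies `φ' = -t 𝔼U² φ`. -/
lemma norm_expWeighted_sumCubes_sub_le (h0 : ∀ a, ∫ x, x a ∂μ = 0) {θ p : ℝ} (hθ : 0 ≤ θ)
    (hp : 0 < p) (hσ : ∀ a, coordCov μ a a ≤ θ / p ^ 2)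
    (hrow : ∀ a, ∑ b, |coordCov μ a b| ≤ 2 * θ) (hcard : (Fintype.card ι : ℝ) ≤ p ^ 4) (t : ℝ) :
    ‖Complex.I * expWeighted μ t sumCubes +
      t * (∫ x, sumCubes x ^ 2 ∂μ : ℝ) * expWeighted μ t (fun _ => 1)‖ ≤
      18 * θ * cubicRemainder θ * t ^ 2 / p := by
  choose R hR hRe using exists_expWeighted_expansion h0 hθ hp hσ hrow t
  have e : expWeighted μ t sumCubes = ∑ a, expWeighted μ t (fun x => x a ^ 3) :=
    expWeighted_sum μ t _ fun a => (HasPolyGrowth.coord a).pow 3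
  have id : Complex.I * expWeighted μ t sumCubes +
      t * (∫ x, sumCubes x ^ 2 ∂μ : ℝ) * expWeighted μ t (fun _ => 1) =
      -(9 * Complex.I * t ^ 2) * ∑ a, ∑ b, (coordCov μ a b : ℂ) * R a b := by
    rw [e, integral_sumCubes_sq h0]
    push_cast
    simp_rw [expWeighted_cube t h0, hRe]
    simp only [Finset.mul_sum, Finset.sum_mul, ← Finset.sum_add_distrib]
    refine Finset.sum_congr rfl fun a _ => Finset.sum_congr rfl fun b _ => ?_
    -- By I² = -1 the main terms cancel against t 𝔼U² φ, leaving only R.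
    linear_combination ((coordCov μ a b : ℂ) * 3 * t * ((3 * (coordCov μ a a * coordCov μ b b)
      + 2 * coordCov μ a b ^ 2) * expWeighted μ t (fun _ => 1)) + 9 * Complex.I * t ^ 2 *
        coordCov μ a b * R a b) * Complex.I_sq
  have hk := cubicRemainder_nonneg hθ
  have hb : ‖∑ a, ∑ b, (coordCov μ a b : ℂ) * R a b‖ ≤
      p ^ 4 * (2 * θ * (cubicRemainder θ / p ^ 5)) := by
    refine (norm_sum_le _ _).trans ?_
    refine (Finset.sum_le_card_nsmul _ _ (2 * θ * (cubicRemainder θ / p ^ 5)) fun a _ =>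
      norm_sum_mul_le _ (hrow a) (by positivity) (hR a)).trans ?_
    rw [nsmul_eq_mul, Finset.card_univ]
    gcongr
  rw [id, norm_mul]
  have hn : ‖-(9 * Complex.I * (t : ℂ) ^ 2)‖ = 9 * t ^ 2 := by simp
  rw [hn]
  calc 9 * t ^ 2 * ‖∑ a, ∑ b, (coordCov μ a b : ℂ) * R a b‖
      ≤ 9 * t ^ 2 * (p ^ 4 * (2 * θ * (cubicRemainder θ / p ^ 5))) := by gcongr
    _ = _ := by
      field_simp
      ring

/-- Differentiation under the integral, dominated by the integrable |U| for all t. -/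
lemma hasDerivAt_expWeighted_one (t : ℝ) :
    HasDerivAt (fun t => expWeighted μ t (fun _ => 1))
      (Complex.I * expWeighted μ t sumCubes) t := by
  have hg := hasPolyGrowth_sumCubes (ι := ι)
  have h1 : ∀ s, HasPolyGrowth (fun x : ι → ℝ => (((1 : ℝ) : ℂ)) *
      Complex.exp (Complex.I * ((s * sumCubes x : ℝ) : ℂ))) := fun s =>
    (HasPolyGrowth.const (1 : ℝ)).weighted s
  have h2 := (HasPolyGrowth.const (ι := ι) Complex.I).mul (hg.weighted t)
  have := (hasDerivAt_integral_of_dominated_loc_of_deriv_le (μ := μ) (x₀ := t) (s := Set.univ)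
    (F := fun (s : ℝ) (x : ι → ℝ) => (((1 : ℝ) : ℂ)) *
      Complex.exp (Complex.I * ((s * sumCubes x : ℝ) : ℂ)))
    (F' := fun s x => Complex.I * ((sumCubes x : ℂ) *
      Complex.exp (Complex.I * ((s * sumCubes x : ℝ) : ℂ))))
    (bound := fun x => |sumCubes x|) Filter.univ_mem
    (Filter.Eventually.of_forall fun s => (h1 s).1.aestronglyMeasurable) ((h1 t).integrable μ)
    h2.1.aestronglyMeasurable (ae_of_all _ fun x s _ => ?_) (hg.integrable μ).abs
    (ae_of_all _ fun x s _ => ?_)).2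
  · rwa [integral_const_mul] at this
  · rw [norm_mul, norm_mul, mul_comm Complex.I (Complex.ofReal _), Complex.norm_exp_ofReal_mul_I]
    simp
  · have h : HasDerivAt (fun s : ℝ => s * sumCubes x) (sumCubes x) s := by
      simpa using (hasDerivAt_id s).mul_const (sumCubes x)
    convert! ((h.ofReal_comp.const_mul Complex.I).cexp).const_mul ((1 : ℝ) : ℂ) using 1
    push_cast
    ring

/-- The quantitative Gaussian comparison for the sum of cubes. -/
theorem norm_expWeighted_one_sub_le (h0 : ∀ a, ∫ x, x a ∂μ = 0) {θ p : ℝ} (hθ : 0 ≤ θ)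
    (hp : 0 < p) (hσ : ∀ a, coordCov μ a a ≤ θ / p ^ 2)
    (hrow : ∀ a, ∑ b, |coordCov μ a b| ≤ 2 * θ) (hcard : (Fintype.card ι : ℝ) ≤ p ^ 4) :
    ‖expWeighted μ 1 (fun _ => 1) -
      ((Real.exp (-(1 / 2) * ∫ x, sumCubes x ^ 2 ∂μ) : ℝ) : ℂ)‖ ≤
      18 * θ * cubicRemainder θ / p := by
  set s := ∫ x, sumCubes x ^ 2 ∂μ with hs
  have s0 : 0 ≤ s := integral_nonneg fun x => sq_nonneg _
  have hk := cubicRemainder_nonneg hθ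
  set δ := 18 * θ * cubicRemainder θ / p with hδ
  have δ0 : 0 ≤ δ := by positivity
  -- The integrating factor: g' is e^{st²/2}(φ' + stφ).
  let g : ℝ → ℂ := fun t => ((Real.exp (s / 2 * t ^ 2) : ℝ) : ℂ) * expWeighted μ t (fun _ => 1)
  have hg : ∀ t, HasDerivAt g (((Real.exp (s / 2 * t ^ 2) : ℝ) : ℂ) *
      (Complex.I * expWeighted μ t sumCubes + t * s * expWeighted μ t (fun _ => 1))) t := by
    intro t
    have h1 : HasDerivAt (fun t : ℝ => Real.exp (s / 2 * t ^ 2))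
        (Real.exp (s / 2 * t ^ 2) * (s * t)) t := by
      convert! (((hasDerivAt_pow 2 t).const_mul (s / 2))).exp using 1
      simp
      ring
    convert! h1.ofReal_comp.mul (hasDerivAt_expWeighted_one (μ := μ) t) using 1
    push_cast
    ring
  have hb : ∀ t ∈ Set.Ico (0 : ℝ) 1, ‖((Real.exp (s / 2 * t ^ 2) : ℝ) : ℂ) *
      (Complex.I * expWeighted μ t sumCubes + t * s * expWeighted μ t (fun _ => 1))‖ ≤
      Real.exp (s / 2) * δ := by
    intro t ht
    have t1 : t ^ 2 ≤ 1 := pow_le_one₀ ht.1 ht.2.le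
    rw [norm_mul, Complex.norm_real, Real.norm_of_nonneg (Real.exp_nonneg _)]
    refine mul_le_mul (Real.exp_le_exp.2 (by nlinarith))
      ((norm_expWeighted_sumCubes_sub_le h0 hθ hp hσ hrow hcard t).trans ?_) (norm_nonneg _)
      (Real.exp_nonneg _)
    rw [hδ]
    exact div_le_div_of_nonneg_right (mul_le_of_le_one_right (by positivity) t1) hp.le
  have key := norm_image_sub_le_of_norm_deriv_le_segment' (f := g) (a := 0) (b := 1)
    (fun t _ => (hg t).hasDerivWithinAt) hb 1 (by simp)
  have hg0 : g 0 = 1 := by simp [g, expWeighted]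
  have hg1 : g 1 = ((Real.exp (s / 2) : ℝ) : ℂ) * expWeighted μ 1 (fun _ => 1) := by simp [g]
  rw [hg0, hg1, sub_zero, mul_one] at key
  -- The factor e^{s/2} now divides out, so the final bound does not depend on s.
  have hexp : ((Real.exp (s / 2) : ℝ) : ℂ) * ((Real.exp (-(1 / 2) * s) : ℝ) : ℂ) = 1 := by
    rw [← Complex.ofReal_mul, ← Real.exp_add]
    have : s / 2 + -(1 / 2) * s = 0 := by ring
    rw [this, Real.exp_zero, Complex.ofReal_one]
  rw [← hexp, ← mul_sub, norm_mul, Complex.norm_real, Real.norm_of_nonneg (Real.exp_nonneg _)]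
    at key
  exact le_of_mul_le_mul_left key (Real.exp_pos _)

/-- Each Wick bracket is at most 5(θ/p²)², each row sum at most 2θ, and there are at most p⁴ rows;
the prefactor 3 makes 30. -/
lemma integral_sumCubes_sq_le (h0 : ∀ a, ∫ x, x a ∂μ = 0) {θ p : ℝ} (hθ : 0 ≤ θ)
    (hp : 0 < p) (hσ : ∀ a, coordCov μ a a ≤ θ / p ^ 2)
    (hrow : ∀ a, ∑ b, |coordCov μ a b| ≤ 2 * θ) (hcard : (Fintype.card ι : ℝ) ≤ p ^ 4) :
    ∫ x, sumCubes x ^ 2 ∂μ ≤ 30 * θ ^ 3 := by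
  rw [integral_sumCubes_sq h0]
  have hv : 0 ≤ θ / p ^ 2 := by positivity
  have h : ∀ a, ∑ b, coordCov μ a b *
      (3 * (coordCov μ a a * coordCov μ b b) + 2 * coordCov μ a b ^ 2) ≤
      2 * θ * (5 * (θ / p ^ 2) ^ 2) := by
    intro a
    calc _ ≤ ∑ b, |coordCov μ a b| * (5 * (θ / p ^ 2) ^ 2) := by
          refine Finset.sum_le_sum fun b _ => ?_
          have h1 := mul_le_mul (hσ a) (hσ b) (coordCov_self_nonneg μ b) hv
          have h2 : coordCov μ a b ^ 2 ≤ (θ / p ^ 2) ^ 2 :=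
            sq_le_sq' (neg_le_of_abs_le (abs_coordCov_le hσ a b))
              (le_of_abs_le (abs_coordCov_le hσ a b))
          have h3 := mul_nonneg (coordCov_self_nonneg μ a) (coordCov_self_nonneg μ b)
          exact mul_le_mul (le_abs_self _) (by nlinarith) (by positivity) (abs_nonneg _)
      _ = (∑ b, |coordCov μ a b|) * (5 * (θ / p ^ 2) ^ 2) := (Finset.sum_mul _ _ _).symm
      _ ≤ _ := by
          gcongr
          exact hrow a
  have := (Finset.sum_le_card_nsmul Finset.univ _ _ fun a _ => h a)
  rw [nsmul_eq_mul, Finset.card_univ] at this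
  have h' : (Fintype.card ι : ℝ) * (2 * θ * (5 * (θ / p ^ 2) ^ 2)) ≤
      p ^ 4 * (2 * θ * (5 * (θ / p ^ 2) ^ 2)) := by gcongr
  have e : p ^ 4 * (2 * θ * (5 * (θ / p ^ 2) ^ 2)) = 10 * θ ^ 3 := by
    field_simp
    ring
  linarith

end Clt

/-! ### Arrays -/

/-- The row and column through a contribute (m+n)·θ/N = θ, counting a twice; charging θ/N² to all mn
≤ N² entries adds at most θ. -/
lemma sum_abs_coordCov_le {m n : ℕ} {μ : Measure (Fin m × Fin n → ℝ)} {θ N : ℝ}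
    (hθ : 0 ≤ θ) (hN : 0 < N) (hmn : (m : ℝ) + n = N)
    (hc : ∀ a b, |coordCov μ a b| ≤ θ / N)
    (hfar : ∀ a b, a.1 ≠ b.1 → a.2 ≠ b.2 → |coordCov μ a b| ≤ θ / N ^ 2) (a : Fin m × Fin n) :
    ∑ b, |coordCov μ a b| ≤ 2 * θ := by
  have hN1 : 0 ≤ θ / N := by positivity
  have hN2 : 0 ≤ θ / N ^ 2 := by positivity
  have h : ∀ b, |coordCov μ a b| ≤
      (if a.1 = b.1 then θ / N else 0) + (if a.2 = b.2 then θ / N else 0) + θ / N ^ 2 := by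
    intro b
    have h1 := hc a b
    have h2 := hfar a b
    split_ifs with i1 i2 i2
    · linarith
    · linarith
    · linarith
    · linarith [h2 i1 i2]
  refine (Finset.sum_le_sum fun b _ => h b).trans ?_
  rw [Fintype.sum_prod_type]
  have e0 : ∑ j : Fin m, ∑ _k : Fin n, (if a.1 = j then θ / N else 0) = n * (θ / N) := by
    rw [Finset.sum_comm]
    simp
  simp only [Finset.sum_add_distrib, e0]
  simp only [Finset.sum_const, Finset.card_univ, Fintype.card_fin,
    Finset.sum_ite_eq, Finset.mem_univ, if_true, nsmul_eq_mul]
  have hmn2 : (m : ℝ) * n ≤ N ^ 2 := by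
    rw [← hmn]
    nlinarith [sq_nonneg (m : ℝ), sq_nonneg (n : ℝ),
      mul_nonneg (Nat.cast_nonneg (α := ℝ) m) (Nat.cast_nonneg (α := ℝ) n)]
  have e1 : (m : ℝ) * (n * (θ / N ^ 2)) ≤ θ := by
    have : (m : ℝ) * (n * (θ / N ^ 2)) = (m * n) * (θ / N ^ 2) := by ring
    rw [this]
    calc (m * n : ℝ) * (θ / N ^ 2) ≤ N ^ 2 * (θ / N ^ 2) := by gcongr
      _ = θ := by field_simp
  have e2 : (n : ℝ) * (θ / N) + m * (θ / N) = θ := by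
    rw [← add_mul, add_comm, hmn]
    field_simp
  linarith

/-- The hypotheses give (1/ε)^{2+K} ≤ p. Bernoulli's inequality gives K ≤ 2^{1+K} ≤ (1/ε)^{1+K}, and
the spare factor 1/ε finishes. -/
lemma mul_le_of_rpow_le {ε K γ p : ℝ} (hε : 0 < ε) (hε2 : ε ≤ 1 / 2) (hK : 0 ≤ K)
    (hp : 0 < p) (hγ : 2 * (2 + K) ≤ γ) (h : (1 / ε) ^ γ ≤ p ^ 2) : K / p ≤ ε := by
  have h2 : 2 ≤ 1 / ε := by
    rw [le_div_iff₀ hε]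
    linarith
  have h0 : (0 : ℝ) < 1 / ε := by positivity
  have h3 : ((1 / ε) ^ (2 + K)) ^ 2 ≤ p ^ 2 := by
    refine le_trans ?_ h
    rw [← Real.rpow_natCast, ← Real.rpow_mul h0.le]
    refine Real.rpow_le_rpow_of_exponent_le (by linarith) ?_
    push_cast
    linarith
  have h4 : (1 / ε) ^ (2 + K) ≤ p := le_of_sq_le_sq h3 hp.le
  have h5 : K ≤ (1 / ε) ^ (1 + K) := by
    have := one_add_mul_self_le_rpow_one_add (s := 1) (by norm_num) (p := 1 + K) (by linarith)
    have h6 : (1 + 1 : ℝ) ^ (1 + K) ≤ (1 / ε) ^ (1 + K) :=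
      Real.rpow_le_rpow (by norm_num) (by linarith) (by linarith)
    exact (by linarith : K ≤ 1 + (1 + K) * 1).trans (this.trans h6)
  have e : (1 / ε) ^ (2 + K) = (1 / ε) * (1 / ε) ^ (1 + K) := by
    rw [← Real.rpow_one_add' h0.le (by linarith)]
    congr 1
    ring
  rw [div_le_iff₀ hp]
  calc K ≤ (1 / ε) ^ (1 + K) := h5
    _ = ε * (1 / ε) ^ (2 + K) := by
      rw [e]
      field_simp
    _ ≤ ε * p := by gcongr

theorem theorem4p1 (θ : ℝ) (hθ : 0 < θ) :
    ∃ γ : ℝ, 0 < γ ∧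
      ∀ (m n : ℕ) (Ω : Type*) [MeasurableSpace Ω] (P : Measure Ω) [IsProbabilityMeasure P]
        (u : Fin m → Fin n → Ω → ℝ),
        -- the variables are jointly Gaussian (the joint law may be degenerate)
        HasGaussianLaw (fun ω (p : Fin m × Fin n) => u p.1 p.2 ω) P →
        (∀ j k, ∫ ω, u j k ω ∂P = 0) →
        (∀ j k, ∫ ω, u j k ω ^ 2 ∂P ≤ θ / ((m : ℝ) + n)) →
        (∀ j₁ j₂ k₁ k₂, j₁ ≠ j₂ → k₁ ≠ k₂ →
          |∫ ω, u j₁ k₁ ω * u j₂ k₂ ω ∂P| ≤ θ / ((m : ℝ) + n) ^ 2) →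
        (Integrable (fun ω => cubicSum u ω ^ 2) P ∧ ∫ ω, cubicSum u ω ^ 2 ∂P ≤ γ) ∧
        ∀ ε : ℝ, 0 < ε → ε ≤ 1 / 2 → (1 / ε) ^ γ ≤ (m : ℝ) + n →
          ‖(∫ ω, Complex.exp (Complex.I * (cubicSum u ω : ℂ)) ∂P) -
              ((Real.exp (-(1 / 2) * ∫ ω, cubicSum u ω ^ 2 ∂P) : ℝ) : ℂ)‖ ≤ ε := by
  have hk := cubicRemainder_nonneg hθ.le
  -- One constant for two purposes: the first summand serves the convergence rate, the second bounds
  -- 𝔼U².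
  refine ⟨2 * (2 + 18 * θ * cubicRemainder θ) + 30 * θ ^ 3, by positivity, ?_⟩
  intro m n Ω _ P _ u hu hmean hvar hfar
  -- For the empty array U = 0 and the claims are trivial; otherwise p > 0.
  rcases Nat.eq_zero_or_pos (m + n) with hmn | hmn
  · obtain ⟨rfl, rfl⟩ : m = 0 ∧ n = 0 := by omega
    refine ⟨by simp [cubicSum]; positivity, fun ε _ _ _ => ?_⟩
    simp [cubicSum]
    positivity
  set X : Ω → (Fin m × Fin n → ℝ) := fun ω q => u q.1 q.2 ω with hX
  have hXm : AEMeasurable X P := hu.aemeasurable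
  set μ := P.map X with hμ
  have : IsGaussian μ := hu.isGaussian_map
  have hN : (0 : ℝ) < (m : ℝ) + n := by exact_mod_cast hmn
  set p := √((m : ℝ) + n) with hpdef
  have hp : 0 < p := Real.sqrt_pos.2 hN
  have hp2 : p ^ 2 = (m : ℝ) + n := Real.sq_sqrt hN.le
  have tr : ∀ {E : Type} [NormedAddCommGroup E] [NormedSpace ℝ E]
      (f : (Fin m × Fin n → ℝ) → E), Continuous f → ∫ x, f x ∂μ = ∫ ω, f (X ω) ∂P :=
    fun f hf => integral_map hXm hf.aestronglyMeasurable
  have h0 : ∀ a, ∫ x, x a ∂μ = 0 := fun a =>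
    (tr _ (continuous_apply a)).trans (hmean a.1 a.2)
  have hcov : ∀ a b, coordCov μ a b = ∫ ω, u a.1 a.2 ω * u b.1 b.2 ω ∂P := fun a b =>
    tr (fun x => x a * x b) (by fun_prop)
  have hσ : ∀ a, coordCov μ a a ≤ θ / p ^ 2 := fun a => by
    rw [hcov, hp2]
    simpa only [pow_two] using hvar a.1 a.2
  have hrow : ∀ a, ∑ b, |coordCov μ a b| ≤ 2 * θ := by
    refine sum_abs_coordCov_le hθ.le (pow_pos hp 2) hp2.symm (abs_coordCov_le hσ) ?_
    intro a b h1 h2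
    rw [hcov, hp2]
    exact hfar _ _ _ _ h1 h2
  have hcard : (Fintype.card (Fin m × Fin n) : ℝ) ≤ p ^ 4 := by
    have e : p ^ 4 = ((m : ℝ) + n) ^ 2 := by rw [← hp2]; ring
    rw [e, Fintype.card_prod, Fintype.card_fin, Fintype.card_fin]
    push_cast
    nlinarith [sq_nonneg (m : ℝ), sq_nonneg (n : ℝ),
      mul_nonneg (Nat.cast_nonneg (α := ℝ) m) (Nat.cast_nonneg (α := ℝ) n)]
  have hU : ∀ ω, cubicSum u ω = sumCubes (X ω) := fun ω => by
    simp only [cubicSum, sumCubes, Fintype.sum_prod_type, hX]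
  have gU := hasPolyGrowth_sumCubes (ι := Fin m × Fin n)
  have hU2 : ∫ ω, cubicSum u ω ^ 2 ∂P = ∫ x, sumCubes x ^ 2 ∂μ := by
    rw [tr _ (gU.pow 2).1]
    simp only [hU]
  refine ⟨⟨?_, ?_⟩, fun ε hε hε2 hlarge => ?_⟩
  · simp only [hU]
    exact (integrable_map_measure (gU.pow 2).1.aestronglyMeasurable hXm).1
      ((gU.pow 2).integrable μ)
  · rw [hU2]
    have := integral_sumCubes_sq_le h0 hθ.le hp hσ hrow hcard
    have : 0 ≤ 2 * (2 + 18 * θ * cubicRemainder θ) := by positivity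
    linarith
  · have hphi : ∫ ω, Complex.exp (Complex.I * (cubicSum u ω : ℂ)) ∂P =
        expWeighted μ 1 (fun _ => 1) := by
      rw [expWeighted, tr _ ((HasPolyGrowth.const (1 : ℝ)).weighted 1).1]
      simp only [hU, one_mul, Complex.ofReal_one]
    rw [hphi, hU2]
    refine (norm_expWeighted_one_sub_le h0 hθ.le hp hσ hrow hcard).trans ?_
    rw [← hp2] at hlarge
    exact mul_le_of_rpow_le hε hε2 (by positivity) hp
      (le_add_of_nonneg_right (by positivity)) hlarge
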